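/- Let $2^\omega$ be Cantor space with the fair-coin (uniform) probability measure $\mu$, and let $X\subseteq\omega$ be a non-computable set. Then every $\mu$-measurable set $A\subseteq 2^\omega$ with $\mu(A)>0$ has a perfect subset that does not compute $X$, i.e. there is a nonempty closed set $C\subseteq A$ without isolated points such that $X$ is not Turing computable from the tree $\{\sigma\in 2^{<\omega} : \sigma \text{ is an initial segment of some } x\in C\}$. -/

import Mathlib

/-- The fair-coin (uniform, Lebesgue) probability measure on Cantor space `2^ω`: the product over
`ℕ` of the uniform probability measure on `{0, 1}`. -/
noncomputable def coinMeasure : MeasureTheory.Measure (ℕ → Bool) :=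
  MeasureTheory.Measure.infinitePi fun _ : ℕ => (PMF.uniformOfFintype Bool).toMeasure

/-- The binary tree identified with a set `C ⊆ 2^ω`: the set of all finite binary strings which
are an initial segment of some member of `C`. -/
def initialSegmentTree (C : Set (ℕ → Bool)) : Set (List Bool) :=
  {σ | ∃ x ∈ C, ∀ (i : ℕ) (hi : i < σ.length), σ[i] = x i}

open Classical in
/-- The characteristic function, as a (total) function on `ℕ`, of a set `A` of natural numbers,
finite binary strings or other finite objects. A finite object is identified with its code under
the standard coding; the code of a natural number is the number itself. -/
noncomputable def codedCharFun {α : Type*} [Primcodable α] (A : Set α) : ℕ →. ℕ :=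
  fun n => Part.some (if ∃ a ∈ A, Encodable.encode a = n then 1 else 0)

/-- The set `X` of natural numbers is computable from `A`, i.e. the characteristic function of `X`
is Turing reducible to that of `A`. -/
def ComputesSet {α : Type*} [Primcodable α] (A : Set α) (X : Set ℕ) : Prop :=
  TuringReducible (codedCharFun X) (codedCharFun A)

/-! The proof is a forcing construction. A condition is a finite tree together with a closed
reservoir that fills more than half of the cylinder above each leaf. Extending a condition grows the
tree and shrinks the reservoir; a sequence of extensions, with leaves that keep branching,
determines a perfect set inside every reservoir. There are countably many oracle programs, so it
suffices to defeat one program `c` by one extension (`exists_forcesNe`).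

For a finite tree `F`, the relation `Forced c F n v` asks for a level at which every half-dense set
of strings contains an end-extension of `F` making `c` output `v` at `n`. It does not mention the
reservoir, and it is r.e. in `n` (`rePred_forced`). Three cases arise. If a wrong value is forced,
the strings of positive reservoir measure form a half-dense set, so some end-extension of the tree
within it produces that wrong value. If a correct value is not forced, a limit of half-dense
counterexamples gives a closed set `K`, of relative measure at least one half above each leaf, none
of whose subsets with tree `F` yields this value (`exists_isClosed_of_not_forced`). It meets the
reservoir in positive measure, because one half and more than one half add up to more than one.
Otherwise forcing decides `X` correctly everywhere, so `X` and its complement are both r.e., a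
contradiction. -/

/-! ### Oracle programs: effectivity, monotonicity and the use principle -/

/-- Programs for oracle machines, following the clauses of `Nat.RecursiveIn`. -/
inductive OracleCode : Type
  | zero : OracleCode
  | succ : OracleCode
  | left : OracleCode
  | right : OracleCode
  | oracle : OracleCode
  | pair : OracleCode → OracleCode → OracleCode
  | comp : OracleCode → OracleCode → OracleCode
  | prec : OracleCode → OracleCode → OracleCode
  | rfind : OracleCode → OracleCode
  deriving Countable

namespace OracleCode

/-- The partial function computed by a program from an oracle. -/
def eval (g : ℕ →. ℕ) : OracleCode → ℕ →. ℕ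
  | zero => fun _ => Part.some 0
  | succ => fun n => Part.some (n + 1)
  | left => fun n => Part.some (Nat.unpair n).1
  | right => fun n => Part.some (Nat.unpair n).2
  | oracle => g
  | pair f h => fun n => (eval g f n).bind fun a => (eval g h n).map fun b => Nat.pair a b
  | comp f h => fun n => (eval g h n).bind (eval g f)
  | prec f h => fun p =>
      (Nat.rec (eval g f p.unpair.1)
        (fun y IH => IH.bind fun i => eval g h (Nat.pair p.unpair.1 (Nat.pair y i)))
        p.unpair.2 : Part ℕ)
  | rfind f => fun a =>
      Nat.rfind fun n => (eval g f (Nat.pair a n)).map fun m => decide (m = 0)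

theorem exists_eval_eq_of_recursiveIn {f g : ℕ →. ℕ} (h : Nat.RecursiveIn {g} f) :
    ∃ c : OracleCode, eval g c = f := by
  induction h with
  | zero => exact ⟨zero, rfl⟩
  | succ => exact ⟨succ, rfl⟩
  | left => exact ⟨left, rfl⟩
  | right => exact ⟨right, rfl⟩
  | oracle g' hg => exact ⟨oracle, by rw [Set.mem_singleton_iff.1 hg]; rfl⟩
  | pair _ _ ihf ihh =>
    obtain ⟨c, rfl⟩ := ihf
    obtain ⟨d, rfl⟩ := ihh
    refine ⟨pair c d, funext fun n => ?_⟩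
    simp [eval, Seq.seq, Part.bind_map]
  | comp _ _ ihf ihh =>
    obtain ⟨c, rfl⟩ := ihf
    obtain ⟨d, rfl⟩ := ihh
    exact ⟨comp c d, rfl⟩
  | prec _ _ ihf ihh =>
    obtain ⟨c, rfl⟩ := ihf
    obtain ⟨d, rfl⟩ := ihh
    exact ⟨prec c d, rfl⟩
  | rfind _ ihf =>
    obtain ⟨c, rfl⟩ := ihf
    exact ⟨rfind c, rfl⟩

/-- `OracleCode` is countable, so the reductions to be defeated can be listed in one sequence. -/
theorem exists_eval_eq_of_turingReducible {f g : ℕ →. ℕ} (h : TuringReducible f g) :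
    ∃ c : OracleCode, eval g c = f :=
  exists_eval_eq_of_recursiveIn (RecursiveIn.iff_nat.1 h)

theorem mem_eval_comp {g : ℕ →. ℕ} {f h : OracleCode} {n v : ℕ} :
    v ∈ eval g (comp f h) n ↔ ∃ a ∈ eval g h n, v ∈ eval g f a :=
  Part.mem_bind_iff

theorem mem_eval_rfind {g : ℕ →. ℕ} {f : OracleCode} {n v : ℕ} :
    v ∈ eval g (rfind f) n ↔ 0 ∈ eval g f (Nat.pair n v) ∧
      ∀ m < v, ∃ a ∈ eval g f (Nat.pair n m), a ≠ 0 := by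
  refine (Nat.mem_rfind (p := fun m => (eval g f (Nat.pair n m)).map fun a => decide (a = 0))).trans
    (and_congr ?_ (forall₂_congr fun m _ => ?_)) <;> simp [Part.mem_map_iff]

/-- A program with a uniformly partial recursive family of oracles is partial recursive. -/
theorem partrec_eval {α : Type*} [Primcodable α] {g : α → ℕ →. ℕ} (hg : Partrec₂ g)
    (c : OracleCode) : Partrec fun p : α × ℕ => eval (g p.1) c p.2 := by
  have sub : ∀ {β : Type _} [Primcodable β] (d : OracleCode) {u : β → α} {w : β → ℕ},
      (Partrec fun p : α × ℕ => eval (g p.1) d p.2) → Computable u → Computable w →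
      Partrec fun b => eval (g (u b)) d (w b) := fun d u w hd hu hw => hd.comp (hu.pair hw)
  induction c with
  | zero => exact (Computable.const 0 : Computable fun _ : α × ℕ => 0).partrec
  | succ => exact (Computable.succ.comp Computable.snd : Computable fun p : α × ℕ => p.2 + 1).partrec
  | left =>
    exact (Computable.fst.comp (Computable.unpair.comp Computable.snd) :
      Computable fun p : α × ℕ => p.2.unpair.1).partrec
  | right =>
    exact (Computable.snd.comp (Computable.unpair.comp Computable.snd) :
      Computable fun p : α × ℕ => p.2.unpair.2).partrec
  | oracle => exact hg
  | pair f h ihf ihh =>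
    refine Partrec.bind (f := fun p : α × ℕ => eval (g p.1) f p.2)
      (g := fun (p : α × ℕ) (a : ℕ) => (eval (g p.1) h p.2).map fun b => Nat.pair a b) ihf ?_
    refine Partrec.map (f := fun q : (α × ℕ) × ℕ => eval (g q.1.1) h q.1.2)
      (g := fun q b => Nat.pair q.2 b) ?_ ?_
    · exact sub h ihh (Computable.fst.comp Computable.fst) (Computable.snd.comp Computable.fst)
    · exact (Primrec₂.natPair.comp (Primrec.snd.comp Primrec.fst) Primrec.snd).to_comp
  | comp f h ihf ihh =>
    refine Partrec.bind (f := fun p : α × ℕ => eval (g p.1) h p.2)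
      (g := fun (p : α × ℕ) (a : ℕ) => eval (g p.1) f a) ihh ?_
    exact sub f ihf (Computable.fst.comp Computable.fst) Computable.snd
  | prec f h ihf ihh =>
    refine Partrec.nat_rec (f := fun p : α × ℕ => p.2.unpair.2)
      (g := fun p : α × ℕ => eval (g p.1) f p.2.unpair.1)
      (h := fun (p : α × ℕ) (q : ℕ × ℕ) =>
        eval (g p.1) h (Nat.pair p.2.unpair.1 (Nat.pair q.1 q.2))) ?_ ?_ ?_
    · exact Computable.snd.comp (Computable.unpair.comp Computable.snd)
    · exact sub f ihf Computable.fst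
        (Computable.fst.comp (Computable.unpair.comp Computable.snd))
    · refine sub (β := (α × ℕ) × (ℕ × ℕ)) h ihh (u := fun b => b.1.1)
        (w := fun b => Nat.pair b.1.2.unpair.1 (Nat.pair b.2.1 b.2.2))
        (Computable.fst.comp Computable.fst) ?_
      exact (Primrec₂.natPair.comp (Primrec.fst.comp (Primrec.unpair.comp
        (Primrec.snd.comp Primrec.fst))) (Primrec₂.natPair.comp (Primrec.fst.comp Primrec.snd)
        (Primrec.snd.comp Primrec.snd))).to_comp
  | rfind f ihf =>
    refine Partrec.rfind (p := fun (p : α × ℕ) (n : ℕ) =>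
      (eval (g p.1) f (Nat.pair p.2 n)).map fun m => decide (m = 0)) ?_
    refine Partrec.map (f := fun q : (α × ℕ) × ℕ => eval (g q.1.1) f (Nat.pair q.1.2 q.2))
      (g := fun _ m => decide (m = 0)) ?_ ?_
    · exact sub f ihf (Computable.fst.comp Computable.fst)
        (Primrec₂.natPair.comp (Primrec.snd.comp Primrec.fst) Primrec.snd).to_comp
    · exact (PrimrecPred.decide (Primrec.eq.comp Primrec.snd (Primrec.const 0))).to_comp

/-- Oracles are partial so that a truncated tree is a restriction of the full one. Convergent
computations then survive when the truncation level grows. -/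
theorem mem_eval_mono {g g' : ℕ →. ℕ} (hg : ∀ n v, v ∈ g n → v ∈ g' n) (c : OracleCode) :
    ∀ n v, v ∈ eval g c n → v ∈ eval g' c n := by
  induction c with
  | zero | succ | left | right => exact fun n v h => h
  | oracle => exact hg
  | pair f h ihf ihh =>
    intro n v hv
    simp only [eval, Part.mem_bind_iff, Part.mem_map_iff] at hv ⊢
    obtain ⟨a, ha, b, hb, rfl⟩ := hv
    exact ⟨a, ihf _ _ ha, b, ihh _ _ hb, rfl⟩
  | comp f h ihf ihh =>
    intro n v hv
    rw [mem_eval_comp] at hv ⊢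
    obtain ⟨a, ha, hv⟩ := hv
    exact ⟨a, ihh _ _ ha, ihf _ _ hv⟩
  | prec f h ihf ihh =>
    intro p v hv
    simp only [eval] at hv ⊢
    generalize p.unpair.2 = m at hv ⊢
    induction m generalizing v with
    | zero => exact ihf _ _ hv
    | succ m ih =>
      simp only [Part.mem_bind_iff] at hv ⊢
      obtain ⟨a, ha, hv⟩ := hv
      exact ⟨a, ih _ ha, ihh _ _ hv⟩
  | rfind f ihf =>
    intro n v hv
    rw [mem_eval_rfind] at hv ⊢
    exact ⟨ihf _ _ hv.1, fun m hm => (hv.2 m hm).imp fun a ha => ⟨ihf _ _ ha.1, ha.2⟩⟩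

/-- A convergent computation uses only part of its oracle. -/
theorem exists_mem_eval_of_mem_eval {g : ℕ →. ℕ} {G : ℕ → ℕ →. ℕ}
    (hmono : ∀ i j, i ≤ j → ∀ n v, v ∈ G i n → v ∈ G j n)
    (hsup : ∀ n v, v ∈ g n → ∃ i, v ∈ G i n) (c : OracleCode) :
    ∀ n v, v ∈ eval g c n → ∃ i, v ∈ eval (G i) c n := by
  have lift : ∀ (d : OracleCode) i j, i ≤ j → ∀ n v, v ∈ eval (G i) d n → v ∈ eval (G j) d n :=
    fun d i j hij => mem_eval_mono (hmono i j hij) d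
  induction c with
  | zero | succ | left | right => exact fun n v h => ⟨0, h⟩
  | oracle => exact hsup
  | pair f h ihf ihh =>
    intro n v hv
    simp only [eval, Part.mem_bind_iff, Part.mem_map_iff] at hv ⊢
    obtain ⟨a, ha, b, hb, rfl⟩ := hv
    obtain ⟨i, hi⟩ := ihf _ _ ha
    obtain ⟨j, hj⟩ := ihh _ _ hb
    exact ⟨max i j, a, lift _ _ _ (le_max_left _ _) _ _ hi, b,
      lift _ _ _ (le_max_right _ _) _ _ hj, rfl⟩
  | comp f h ihf ihh =>
    intro n v hv
    simp only [mem_eval_comp] at hv ⊢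
    obtain ⟨a, ha, hv⟩ := hv
    obtain ⟨i, hi⟩ := ihh _ _ ha
    obtain ⟨j, hj⟩ := ihf _ _ hv
    exact ⟨max i j, a, lift _ _ _ (le_max_left _ _) _ _ hi,
      lift _ _ _ (le_max_right _ _) _ _ hj⟩
  | prec f h ihf ihh =>
    intro p v hv
    have key : ∀ (q m : ℕ) v, v ∈ (Nat.rec (eval g f q)
        (fun y IH => IH.bind fun i => eval g h (Nat.pair q (Nat.pair y i))) m : Part ℕ) →
        ∃ i, v ∈ (Nat.rec (eval (G i) f q)
        (fun y IH => IH.bind fun j => eval (G i) h (Nat.pair q (Nat.pair y j))) m : Part ℕ) := by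
      intro q m
      induction m with
      | zero => exact ihf q
      | succ m ih =>
        intro v hv
        simp only [Part.mem_bind_iff] at hv ⊢
        obtain ⟨a, ha, hv⟩ := hv
        obtain ⟨i, hi⟩ := ih _ ha
        obtain ⟨j, hj⟩ := ihh _ _ hv
        refine ⟨max i j, a, ?_, lift _ _ _ (le_max_right _ _) _ _ hj⟩
        have := lift (prec f h) _ _ (le_max_left i j) (Nat.pair q m) a
        simp only [eval, Nat.unpair_pair] at this
        exact this hi
    exact key _ _ _ hv
  | rfind f ihf =>
    intro n v hv
    simp only [mem_eval_rfind] at hv ⊢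
    obtain ⟨h0, hlt⟩ := hv
    obtain ⟨i, hi⟩ := ihf _ _ h0
    have : ∀ m, ∃ j, m < v → ∃ b ∈ eval (G j) f (Nat.pair n m), b ≠ 0 := by
      intro m
      by_cases hm : m < v
      · obtain ⟨b, hb, hb0⟩ := hlt m hm
        obtain ⟨j, hj⟩ := ihf _ _ hb
        exact ⟨j, fun _ => ⟨b, hj, hb0⟩⟩
      · exact ⟨0, fun h => (hm h).elim⟩
    choose j hj using this
    refine ⟨max i ((Finset.range v).sup j), lift _ _ _ (le_max_left _ _) _ _ hi, ?_⟩
    intro m hm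
    obtain ⟨b, hb, hb0⟩ := hj m hm
    exact ⟨b, lift _ _ _ ((Finset.le_sup (Finset.mem_range.2 hm)).trans (le_max_right _ _))
      _ _ hb, hb0⟩

end OracleCode

/-! ### Binary strings and the r.e. forcing relation -/

theorem primrec_sublists' {α : Type*} [Primcodable α] : Primrec (List.sublists' (α := α)) := by
  refine (Primrec.list_foldr (f := fun l : List α => l) (g := fun _ => [[]])
    (h := fun _ p => p.2 ++ p.2.map (List.cons p.1)) Primrec.id (Primrec.const _) ?_).of_eq
    fun l => ?_
  · refine Primrec.list_append.comp (Primrec.snd.comp Primrec.snd)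
      (Primrec.list_map (Primrec.snd.comp Primrec.snd) ?_)
    exact Primrec.list_cons.comp (Primrec.fst.comp (Primrec.snd.comp Primrec.fst)) Primrec.snd
  · induction l with
    | nil => rfl
    | cons a l ih => rw [List.foldr_cons, ih, List.sublists'_cons]

theorem primrecRel_isPrefix {α : Type*} [Primcodable α] [DecidableEq α] :
    PrimrecRel fun s t : List α => s <+: t :=
  (Primrec.eq.comp₂ Primrec₂.left (Primrec.list_take.comp₂
    (Primrec.list_length.comp₂ Primrec₂.left) Primrec₂.right)).of_eq
    fun _ _ => List.prefix_iff_eq_take.symm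

/-- The list of all binary strings of a given length. -/
def levelStrings : ℕ → List (List Bool)
  | 0 => [[]]
  | n + 1 => (levelStrings n).map (List.cons false) ++ (levelStrings n).map (List.cons true)

theorem primrec_levelStrings : Primrec levelStrings := by
  refine (Primrec.nat_rec₁ (f := fun _ L => L.map (List.cons false) ++ L.map (List.cons true))
    [[]] ?_).of_eq fun n => ?_
  · refine Primrec.list_append.comp (Primrec.list_map Primrec.snd ?_)
      (Primrec.list_map Primrec.snd ?_) <;>
    exact Primrec.list_cons.comp (Primrec.const _) Primrec.snd
  · induction n with
    | zero => rfl
    | succ n ih => simp only [levelStrings, ← ih]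

theorem mem_levelStrings {n : ℕ} {s : List Bool} : s ∈ levelStrings n ↔ s.length = n := by
  induction n generalizing s with
  | zero => simp [levelStrings]
  | succ n ih =>
    cases s with
    | nil => simp [levelStrings]
    | cons b s => cases b <;> simp [levelStrings, ih]

theorem nodup_levelStrings (n : ℕ) : (levelStrings n).Nodup := by
  induction n with
  | zero => simp [levelStrings]
  | succ n ih =>
    refine List.Nodup.append (ih.map List.cons_injective) (ih.map List.cons_injective) ?_
    intro s hs ht
    obtain ⟨a, -, rfl⟩ := List.mem_map.1 hs
    obtain ⟨b, -, hb⟩ := List.mem_map.1 ht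
    simp at hb

/-- The characteristic function of the tree generated by `G`, defined for strings of length at
most `l` only. -/
def treeOracle (l : ℕ) (G : List (List Bool)) : ℕ →. ℕ := fun k =>
  -- A number that codes no string gets the value 0, as in `codedCharFun`. The test
  -- `Encodable.encode s = k` excludes numbers that decode to `s` without being its code.
  ((Encodable.decode (α := List Bool) k).casesOn (some 0) fun s =>
    if s.length ≤ l then some (if Encodable.encode s = k ∧ ∃ t ∈ G, s <+: t then 1 else 0)
    else none : Option ℕ)

theorem partrec_treeOracle :
    Partrec fun p : (ℕ × List (List Bool)) × ℕ => treeOracle p.1.1 p.1.2 p.2 := by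
  refine Computable.ofOption (Primrec.to_comp (Primrec.option_casesOn
    (Primrec.decode.comp Primrec.snd) (Primrec.const (some 0))
    (Primrec.ite ?_ (Primrec.option_some.comp (Primrec.ite (PrimrecPred.and ?_ ?_)
      (Primrec.const 1) (Primrec.const 0))) (Primrec.const none))))
  · exact Primrec.nat_le.comp (Primrec.list_length.comp Primrec.snd)
      (Primrec.fst.comp (Primrec.fst.comp Primrec.fst))
  · exact Primrec.eq.comp (Primrec.encode.comp Primrec.snd) (Primrec.snd.comp Primrec.fst)
  · exact (PrimrecRel.exists_mem_list (R := fun t s : List Bool => s <+: t)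
      (primrecRel_isPrefix.comp Primrec.snd Primrec.fst)).comp
      (Primrec.snd.comp (Primrec.fst.comp Primrec.fst)) Primrec.snd

/-- At least half of the strings of length `l` above each member of `F` belong to `B`. -/
def HalfDense (F : List (List Bool)) (l : ℕ) (B : List (List Bool)) : Prop :=
  ∀ s ∈ F, 2 ^ l ≤ 2 * 2 ^ s.length * (B.filter (s <+: ·)).length

/-- Each member of `G` extends one of `F`, and each member of `F` is extended by one of `G`. -/
def Spans (F G : List (List Bool)) : Prop :=
  (∀ t ∈ G, ∃ s ∈ F, s <+: t) ∧ ∀ s ∈ F, ∃ t ∈ G, s <+: t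

/-- Any half-dense set of strings contains a finite tree over `F` from which `c` computes the
value `v` at `n`. -/
def Forced (c : OracleCode) (F : List (List Bool)) (n v : ℕ) : Prop :=
  ∃ l, (∀ s ∈ F, s.length ≤ l) ∧ ∀ B ∈ (levelStrings l).sublists', HalfDense F l B →
    ∃ G ∈ B.sublists', Spans F G ∧ v ∈ c.eval (treeOracle l G) n

theorem primrecRel_halfDense (F : List (List Bool)) : PrimrecRel (HalfDense F) := by
  have key : PrimrecRel fun (s : List Bool) (p : ℕ × List (List Bool)) =>
      2 ^ p.1 ≤ 2 * 2 ^ s.length * (p.2.filter fun t => decide (s <+: t)).length := by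
    have hpow : Primrec₂ fun a b : ℕ => a ^ b :=
      (Primrec₂.unpaired'.1 Nat.Primrec.pow)
    have hfil : Primrec₂ fun (L : List (List Bool)) (s : List Bool) =>
        L.filter fun t => decide (s <+: t) :=
      PrimrecRel.listFilter (R := fun t s : List Bool => s <+: t)
        (primrecRel_isPrefix.comp Primrec.snd Primrec.fst)
    refine Primrec.nat_le.comp (hpow.comp (Primrec.const 2) (Primrec.fst.comp Primrec.snd))
      (Primrec.nat_mul.comp (Primrec.nat_mul.comp (Primrec.const 2) (hpow.comp (Primrec.const 2)
        (Primrec.list_length.comp Primrec.fst))) (Primrec.list_length.comp ?_))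
    exact hfil.comp (Primrec.snd.comp Primrec.snd) Primrec.fst
  exact key.forall_mem_list.comp (Primrec.const F) Primrec.id

theorem primrecPred_spans (F : List (List Bool)) : PrimrecPred (Spans F) := by
  refine PrimrecPred.and ?_ ?_
  · exact (PrimrecRel.exists_mem_list (primrecRel_isPrefix (α := Bool)) |>.comp
      (Primrec.const F) Primrec.id).forall_mem_list
  · exact (PrimrecRel.forall_mem_list (R := fun (s : List Bool) (G : List (List Bool)) =>
      ∃ t ∈ G, s <+: t) ((PrimrecRel.exists_mem_list (R := fun t s : List Bool => s <+: t)
      (primrecRel_isPrefix.comp Primrec.snd Primrec.fst)).comp Primrec.snd Primrec.fst)).comp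
      (Primrec.const F) Primrec.id

theorem rePred_exists {α : Type*} [Primcodable α] {p : α → ℕ → Prop} (hp : PrimrecRel p) :
    REPred fun a => ∃ k, p a k := by
  classical
  refine (Partrec.dom_re (f := fun a => Nat.rfind fun k => Part.some (decide (p a k)))
    (Partrec.rfind ?_)).of_eq fun a => ?_
  · exact (PrimrecPred.decide hp).to_comp.partrec
  · refine Nat.rfind_dom.trans ⟨fun ⟨k, hk, _⟩ => ⟨k, ?_⟩, fun ⟨k, hk⟩ => ⟨k, ?_, fun _ => trivial⟩⟩
    · simpa using (Part.mem_some_iff.1 hk).symm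
    · exact Part.mem_some_iff.2 (by simpa using hk)

/-- Apart from the level `l` and the convergence of `c`, every quantifier in `Forced` runs over a
finite list. With convergence bounded by a number of steps, the matrix is primitive recursive; the
search runs over pairs of a level and a step bound. -/
theorem rePred_forced (c : OracleCode) (F : List (List Bool)) (v : ℕ) :
    REPred fun n => Forced c F n v := by
  obtain ⟨d, hd⟩ := Nat.Partrec.Code.exists_code.1
    (OracleCode.partrec_eval (g := fun p : ℕ × List (List Bool) => treeOracle p.1 p.2)
      partrec_treeOracle c)
  have hd : ∀ l G n v, v ∈ c.eval (treeOracle l G) n ↔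
      ∃ k, Encodable.encode v ∈ Nat.Partrec.Code.evaln k d (Encodable.encode ((l, G), n)) := by
    intro l G n v
    rw [← Nat.Partrec.Code.evaln_complete, hd]
    beta_reduce
    rw [Encodable.encodek]
    simp only [Part.coe_some, Part.bind_some, Part.mem_map_iff]
    exact ⟨fun h => ⟨v, h, rfl⟩, fun ⟨w, h, hw⟩ => Encodable.encode_injective hw ▸ h⟩
  have hR : PrimrecRel fun (n : ℕ) (q : ℕ) => (∀ s ∈ F, s.length ≤ q.unpair.1) ∧
      ∀ B ∈ (levelStrings q.unpair.1).sublists', HalfDense F q.unpair.1 B →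
      ∃ G ∈ B.sublists', Spans F G ∧ Encodable.encode v ∈
        Nat.Partrec.Code.evaln q.unpair.2 d (Encodable.encode ((q.unpair.1, G), n)) := by
    have h1 : PrimrecRel fun (G : List (List Bool)) (p : ℕ × ℕ) => Spans F G ∧
        Encodable.encode v ∈ Nat.Partrec.Code.evaln p.2.unpair.2 d
          (Encodable.encode ((p.2.unpair.1, G), p.1)) := by
      refine PrimrecPred.and ((primrecPred_spans F).comp Primrec.fst) ?_
      refine (Primrec.eq.comp (Nat.Partrec.Code.primrec_evaln.comp (Primrec.pair (Primrec.pair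
        (Primrec.snd.comp (Primrec.unpair.comp (Primrec.snd.comp Primrec.snd))) (Primrec.const d))
        (Primrec.encode.comp (Primrec.pair (Primrec.pair (Primrec.fst.comp (Primrec.unpair.comp
        (Primrec.snd.comp Primrec.snd))) Primrec.fst) (Primrec.fst.comp Primrec.snd)))))
        (Primrec.const (some (Encodable.encode v)))).of_eq fun p => ?_
      exact Iff.rfl
    have h2 : PrimrecRel fun (B : List (List Bool)) (p : ℕ × ℕ) => HalfDense F p.2.unpair.1 B →
        ∃ G ∈ B.sublists', Spans F G ∧ Encodable.encode v ∈
          Nat.Partrec.Code.evaln p.2.unpair.2 d (Encodable.encode ((p.2.unpair.1, G), p.1)) := by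
      refine (PrimrecPred.or (PrimrecPred.not ((primrecRel_halfDense F).comp (Primrec.fst.comp
        (Primrec.unpair.comp (Primrec.snd.comp Primrec.snd))) Primrec.fst))
        (h1.exists_mem_list.comp (primrec_sublists'.comp Primrec.fst) Primrec.snd)).of_eq
        fun p => imp_iff_not_or.symm
    refine PrimrecPred.and ((PrimrecRel.forall_mem_list (R := fun (s : List Bool) l => s.length ≤ l)
      (Primrec.nat_le.comp (Primrec.list_length.comp Primrec.fst) Primrec.snd)).comp
      (Primrec.const F) (Primrec.fst.comp (Primrec.unpair.comp Primrec.snd))) ?_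
    exact h2.forall_mem_list.comp (primrec_sublists'.comp (primrec_levelStrings.comp
      (Primrec.fst.comp (Primrec.unpair.comp Primrec.snd)))) Primrec.id
  refine (rePred_exists hR).of_eq fun n => ⟨?_, ?_⟩
  · rintro ⟨q, hlen, hq⟩
    refine ⟨q.unpair.1, hlen, fun B hB hF => ?_⟩
    obtain ⟨G, hG, hs, hv⟩ := hq B hB hF
    exact ⟨G, hG, hs, (hd _ _ _ _).2 ⟨_, hv⟩⟩
  · rintro ⟨l, hlen, hl⟩
    -- There are finitely many `B`, and `evaln` is monotone in the step bound, so one bound serves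
    -- all of them.
    have : ∀ᶠ k in Filter.atTop, ∀ B ∈ {B | B ∈ (levelStrings l).sublists'}, HalfDense F l B →
        ∃ G ∈ B.sublists', Spans F G ∧ Encodable.encode v ∈
          Nat.Partrec.Code.evaln k d (Encodable.encode ((l, G), n)) := by
      refine (Filter.eventually_all_finite (List.finite_toSet _)).2 fun B hB => ?_
      by_cases hF : HalfDense F l B
      · obtain ⟨G, hG, hs, hv⟩ := hl B hB hF
        obtain ⟨k, hk⟩ := (hd _ _ _ _).1 hv
        filter_upwards [Filter.eventually_ge_atTop k] with j hj _
        exact ⟨G, hG, hs, Nat.Partrec.Code.evaln_mono hj hk⟩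
      · exact Filter.Eventually.of_forall fun _ h => (hF h).elim
    obtain ⟨k, hk⟩ := this.exists
    exact ⟨Nat.pair l k, by simpa using ⟨hlen, by simpa using hk⟩⟩

/-- Post's theorem: a set is computable once it and its complement are r.e. -/
theorem computablePred_of_forced {c : OracleCode} {F : List (List Bool)} {X : Set ℕ}
    (h1 : ∀ n, Forced c F n 1 ↔ n ∈ X) (h0 : ∀ n, Forced c F n 0 ↔ n ∉ X) :
    ComputablePred fun n : ℕ => n ∈ X :=
  ComputablePred.computable_iff_re_compl_re'.2
    ⟨(rePred_forced c F 1).of_eq h1, (rePred_forced c F 0).of_eq h0⟩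

/-! ### Topology and measure of Cantor space -/

open MeasureTheory Topology

/-- The initial segment of `x` of length `n`. -/
def initSeg (x : ℕ → Bool) (n : ℕ) : List Bool := (List.range n).map x

@[simp] theorem length_initSeg (x : ℕ → Bool) (n : ℕ) : (initSeg x n).length = n := by
  simp [initSeg]

theorem initSeg_succ (x : ℕ → Bool) (n : ℕ) : initSeg x (n + 1) = initSeg x n ++ [x n] := by
  simp [initSeg, List.range_succ]

theorem initSeg_prefix (x : ℕ → Bool) {m n : ℕ} (h : m ≤ n) : initSeg x m <+: initSeg x n := by
  induction n, h using Nat.le_induction with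
  | base => exact List.prefix_rfl
  | succ n _ ih => exact ih.trans (initSeg_succ x n ▸ List.prefix_append _ _)

theorem initSeg_eq_of_prefix {x : ℕ → Bool} {s : List Bool} {n : ℕ} (h : s <+: initSeg x n) :
    initSeg x s.length = s := by
  have hl : s.length ≤ n := by simpa using h.length_le
  exact (List.prefix_of_prefix_length_le (initSeg_prefix x hl) h (by simp)).eq_of_length (by simp)

theorem initSeg_eq_iff {x : ℕ → Bool} {s : List Bool} :
    initSeg x s.length = s ↔ ∀ (i : ℕ) (hi : i < s.length), s[i] = x i := by
  constructor
  · intro h i hi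
    have : (initSeg x s.length)[i]'(by simpa using hi) = x i := by simp [initSeg]
    rw [← this]
    congr 1
    exact h.symm
  · intro h
    refine List.ext_getElem (by simp) fun i h1 h2 => ?_
    rw [h i h2]
    simp [initSeg]

theorem mem_initialSegmentTree {C : Set (ℕ → Bool)} {s : List Bool} :
    s ∈ initialSegmentTree C ↔ ∃ x ∈ C, initSeg x s.length = s := by
  simp only [initSeg_eq_iff]
  rfl

theorem exists_initSeg_eq (s : List Bool) : ∃ x, initSeg x s.length = s :=
  ⟨fun i => s.getD i false, initSeg_eq_iff.2 fun i hi => by simp [List.getD, hi]⟩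

theorem isClopen_initSeg_mem (n : ℕ) (S : Set (List Bool)) : IsClopen {x | initSeg x n ∈ S} := by
  have h : IsLocallyConstant fun x : ℕ → Bool => initSeg x n := by
    induction n with
    | zero => exact IsLocallyConstant.const []
    | succ n ih =>
      simp only [initSeg_succ]
      exact ih.comp₂ (IsLocallyConstant.iff_continuous _ |>.2 (continuous_apply n))
        fun s b => s ++ [b]
  exact ⟨⟨h Sᶜ⟩, h S⟩

theorem exists_initSeg_subset_of_mem_nhds {x : ℕ → Bool} {U : Set (ℕ → Bool)} (hU : U ∈ 𝓝 x) :
    ∃ n, ∀ m ≥ n, ∀ y, initSeg y m = initSeg x m → y ∈ U := by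
  obtain ⟨V, hVU, hV, hx⟩ := mem_nhds_iff.1 hU
  obtain ⟨I, u, hu, hI⟩ := isOpen_pi_iff.1 hV x hx
  refine ⟨I.sup id + 1, fun m hm y hy => hVU (hI fun i hi => ?_)⟩
  have him : i < m := (Nat.lt_succ_of_le (Finset.le_sup (f := id) hi)).trans_le hm
  have h := (List.map_inj_left.1 hy) i (List.mem_range.2 him)
  rw [h]
  exact (hu i hi).2

theorem mem_of_initSeg {K : Set (ℕ → Bool)} (hK : IsClosed K) {x : ℕ → Bool}
    (h : ∀ n, ∃ m ≥ n, ∃ y ∈ K, initSeg y m = initSeg x m) : x ∈ K := by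
  by_contra hx
  obtain ⟨n, hn⟩ := exists_initSeg_subset_of_mem_nhds (hK.isOpen_compl.mem_nhds hx)
  obtain ⟨m, hm, y, hy, he⟩ := h n
  exact hn m hm y he hy

/-- The set of all infinite extensions of `s`. -/
def cyl (s : List Bool) : Set (ℕ → Bool) := {x | initSeg x s.length = s}

theorem cyl_subset {s t : List Bool} (h : s <+: t) : cyl t ⊆ cyl s := by
  intro x (hx : initSeg x t.length = t)
  exact initSeg_eq_of_prefix (n := t.length) (by rw [hx]; exact h)

theorem isClopen_cyl (s : List Bool) : IsClopen (cyl s) := isClopen_initSeg_mem s.length {s}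

theorem initSeg_mem_cyl (x : ℕ → Bool) (n : ℕ) : x ∈ cyl (initSeg x n) := by
  simp [cyl]

theorem measurableSet_initSeg_mem (n : ℕ) (S : Set (List Bool)) :
    MeasurableSet {x | initSeg x n ∈ S} := (isClopen_initSeg_mem n S).isOpen.measurableSet

instance : IsProbabilityMeasure coinMeasure := by
  unfold coinMeasure
  infer_instance

theorem coinMeasure_real_cyl (s : List Bool) : coinMeasure.real (cyl s) = (1 / 2) ^ s.length := by
  have h : cyl s = Set.pi (Finset.range s.length) fun i => {s.getD i false} := by
    ext x
    simp only [cyl, Set.mem_ofPred_eq, initSeg_eq_iff, Set.mem_pi, Finset.coe_range, Set.mem_Iio,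
      Set.mem_singleton_iff]
    refine forall₂_congr fun i hi => ?_
    rw [List.getD_eq_getElem _ _ hi, eq_comm]
  rw [h, measureReal_def, coinMeasure, Measure.infinitePi_pi _ (fun _ _ => MeasurableSet.singleton _)]
  simp

theorem measureReal_inter_initSeg_mem_le {K : Set (ℕ → Bool)} {n : ℕ} {c : ℝ}
    {B : List (List Bool)} (hlen : ∀ t ∈ B, t.length = n)
    (h : ∀ t ∈ B, coinMeasure.real (K ∩ cyl t) ≤ c) :
    coinMeasure.real (K ∩ {x | initSeg x n ∈ B}) ≤ B.length * c := by
  induction B with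
  | nil => simp
  | cons a B ih =>
    have hsub : K ∩ {x | initSeg x n ∈ a :: B} ⊆
        (K ∩ cyl a) ∪ (K ∩ {x | initSeg x n ∈ B}) := by
      rintro x ⟨hx, hm⟩
      rcases List.mem_cons.1 hm with hm | hm
      · exact Or.inl ⟨hx, by rw [← hm]; exact initSeg_mem_cyl x n⟩
      · exact Or.inr ⟨hx, hm⟩
    have h1 := ih (fun t ht => hlen t (List.mem_cons_of_mem _ ht))
      (fun t ht => h t (List.mem_cons_of_mem _ ht))
    have h2 := h a List.mem_cons_self
    have h3 := (measureReal_mono hsub (measure_ne_top coinMeasure _)).trans (measureReal_union_le _ _)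
    rw [List.length_cons]
    push_cast
    linarith

theorem measureReal_initSeg_mem {n : ℕ} {B : List (List Bool)} (hB : B.Nodup)
    (hlen : ∀ t ∈ B, t.length = n) :
    coinMeasure.real {x | initSeg x n ∈ B} = B.length * (1 / 2) ^ n := by
  induction B with
  | nil => simp
  | cons a B ih =>
    have han := hlen a List.mem_cons_self
    have heq : {x | initSeg x n ∈ a :: B} = cyl a ∪ {x | initSeg x n ∈ B} := by
      ext x
      simp [cyl, han]
    rw [heq, measureReal_union, coinMeasure_real_cyl, han,
      ih hB.of_cons (fun t ht => hlen t (List.mem_cons_of_mem _ ht)), List.length_cons]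
    · push_cast
      ring
    · refine Set.disjoint_left.2 fun x (hx : initSeg x a.length = a) hm => ?_
      rw [han] at hx
      exact (List.nodup_cons.1 hB).1 (hx ▸ hm)
    · exact measurableSet_initSeg_mem n {s | s ∈ B}

theorem measureReal_initSeg_mem_tendsto {S : ℕ → Set (List Bool)}
    (hS : Antitone fun n => {x | initSeg x n ∈ S n}) :
    Filter.Tendsto (fun n => coinMeasure.real {x | initSeg x n ∈ S n}) Filter.atTop
      (𝓝 (coinMeasure.real {x | ∀ n, initSeg x n ∈ S n})) := by
  rw [Set.ofPred_forall]
  exact (ENNReal.tendsto_toReal (measure_ne_top _ _)).comp (tendsto_measure_iInter_atTop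
    (fun n => (measurableSet_initSeg_mem n (S n)).nullMeasurableSet) hS
    ⟨0, measure_ne_top _ _⟩)

/-- A special case of the Lebesgue density theorem. -/
theorem eventually_exists_dense_extension {K : Set (ℕ → Bool)} (hK : IsClosed K) {s : List Bool}
    (hs : 0 < coinMeasure.real (K ∩ cyl s)) :
    ∀ᶠ n in Filter.atTop, ∃ t : List Bool, t.length = n ∧ s <+: t ∧
      1 / 2 * (1 / 2) ^ n < coinMeasure.real (K ∩ cyl t) := by
  classical
  let S : ℕ → Set (List Bool) := fun n => {t | ∃ y ∈ K ∩ cyl s, initSeg y n = t}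
  have hanti : Antitone fun n => {x | initSeg x n ∈ S n} := by
    rintro m n hmn x ⟨y, hy, hyx⟩
    refine ⟨y, hy, ?_⟩
    have h := initSeg_eq_of_prefix (hyx ▸ initSeg_prefix y hmn)
    simpa using h.symm
  have hinter : {x | ∀ n, initSeg x n ∈ S n} = K ∩ cyl s := by
    ext x
    refine ⟨fun h => mem_of_initSeg (hK.inter (isClopen_cyl s).isClosed) fun n => ⟨n, le_rfl, h n⟩,
      fun h n => ⟨x, h, rfl⟩⟩
  have hlim := measureReal_initSeg_mem_tendsto hanti
  rw [hinter] at hlim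
  -- The clopen hulls of `K ∩ cyl s` at level `n` decrease to it, so eventually they have less than
  -- twice its measure. If `K` filled at most half of each cylinder in the hull, the hull would have
  -- at least twice that measure.
  filter_upwards [hlim.eventually_lt_const (show _ < 2 * coinMeasure.real (K ∩ cyl s) by linarith),
    Filter.eventually_ge_atTop s.length] with n hn hsn
  by_contra! hcon
  set B := (levelStrings n).filter (· ∈ S n) with hBdef
  have hB : ∀ t, t ∈ B ↔ t.length = n ∧ t ∈ S n := fun t => by simp [hBdef, mem_levelStrings]
  have hset : {x | initSeg x n ∈ S n} = {x | initSeg x n ∈ B} := by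
    ext x
    simp [hB]
  have h1 : coinMeasure.real (K ∩ cyl s) ≤ B.length * (1 / 2 * (1 / 2) ^ n) := by
    refine le_trans (measureReal_mono ?_ (measure_ne_top _ _))
      (measureReal_inter_initSeg_mem_le (K := K) (n := n) (fun t ht => ((hB t).1 ht).1)
      fun t ht => ?_)
    · exact fun x hx => ⟨hx.1, hset ▸ ⟨x, hx, rfl⟩⟩
    · obtain ⟨hl, y, hy, rfl⟩ := (hB t).1 ht
      refine hcon _ hl ?_
      have := initSeg_prefix y hsn
      rwa [show initSeg y s.length = s from hy.2] at this
  rw [hset, measureReal_initSeg_mem ((nodup_levelStrings n).filter _)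
    (fun t ht => ((hB t).1 ht).1)] at hn
  linarith

/-! ### Truncated trees and shrinking the reservoir -/

/-- `G` lists the initial segments of length `l` of the members of `C`. -/
def IsTrunc (C : Set (ℕ → Bool)) (l : ℕ) (G : List (List Bool)) : Prop :=
  ∀ s, s ∈ G ↔ ∃ x ∈ C, initSeg x l = s

theorem IsTrunc.length_eq {C : Set (ℕ → Bool)} {l : ℕ} {G : List (List Bool)}
    (h : IsTrunc C l G) {s : List Bool} (hs : s ∈ G) : s.length = l := by
  obtain ⟨x, -, rfl⟩ := (h s).1 hs
  simp

open Classical in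
theorem exists_isTrunc (C : Set (ℕ → Bool)) (l : ℕ) : ∃ G, IsTrunc C l G := by
  refine ⟨(levelStrings l).filter fun s => ∃ x ∈ C, initSeg x l = s, fun s => ?_⟩
  simp only [List.mem_filter, decide_eq_true_eq, mem_levelStrings, and_iff_right_iff_imp]
  rintro ⟨x, -, rfl⟩
  simp

theorem IsTrunc.exists_prefix_iff {C : Set (ℕ → Bool)} {l : ℕ} {G : List (List Bool)}
    (h : IsTrunc C l G) {s : List Bool} (hs : s.length ≤ l) :
    (∃ t ∈ G, s <+: t) ↔ s ∈ initialSegmentTree C := by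
  rw [mem_initialSegmentTree]
  constructor
  · rintro ⟨t, ht, hst⟩
    obtain ⟨x, hx, rfl⟩ := (h t).1 ht
    exact ⟨x, hx, initSeg_eq_of_prefix hst⟩
  · rintro ⟨x, hx, hxs⟩
    exact ⟨_, (h _).2 ⟨x, hx, rfl⟩, hxs ▸ initSeg_prefix x (hxs ▸ hs)⟩

/-- Leaves of equal length are recovered by cutting the longer strings back. Thus a set with the
tree of an extension also has the tree of every earlier condition. -/
theorem spans_trunc_eq {C : Set (ℕ → Bool)} {l m : ℕ} {F G : List (List Bool)}
    (hF : ∀ s ∈ F, s.length = l) (hFG : Spans F G) (hG : IsTrunc C m G) :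
    IsTrunc C l F := by
  have key : ∀ s ∈ F, ∀ x, s <+: initSeg x m → initSeg x l = s := fun s hs x h => by
    rw [← hF s hs]
    exact initSeg_eq_of_prefix h
  intro s
  constructor
  · intro hs
    obtain ⟨t, ht, hst⟩ := hFG.2 s hs
    obtain ⟨x, hx, rfl⟩ := (hG t).1 ht
    exact ⟨x, hx, key s hs x hst⟩
  · rintro ⟨x, hx, rfl⟩
    obtain ⟨s, hs, hst⟩ := hFG.1 _ ((hG _).2 ⟨x, hx, rfl⟩)
    rwa [key s hs x hst]

theorem mem_treeOracle_iff {C : Set (ℕ → Bool)} {l : ℕ} {G : List (List Bool)}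
    (h : IsTrunc C l G) {k v : ℕ} :
    v ∈ treeOracle l G k ↔ (∀ s : List Bool, Encodable.decode k = some s → s.length ≤ l) ∧
      v ∈ codedCharFun (initialSegmentTree C) k := by
  classical
  unfold treeOracle codedCharFun
  rw [Part.mem_some_iff]
  cases hk : Encodable.decode (α := List Bool) k with
  | none =>
    have : ¬ ∃ a ∈ initialSegmentTree C, Encodable.encode a = k := by
      rintro ⟨a, -, rfl⟩
      simp [Encodable.encodek] at hk
    simp [this]
  | some s =>
    by_cases hs : s.length ≤ l
    · have : (Encodable.encode s = k ∧ ∃ t ∈ G, s <+: t) ↔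
          ∃ a ∈ initialSegmentTree C, Encodable.encode a = k := by
        rw [h.exists_prefix_iff hs]
        refine ⟨fun h => ⟨s, h.2, h.1⟩, ?_⟩
        rintro ⟨a, ha, rfl⟩
        rw [Encodable.encodek, Option.some_inj] at hk
        subst hk
        exact ⟨rfl, ha⟩
      simp [hs, this]
    · simp [hs]

/-- A computation from the tree of `C` only uses a truncation of the tree. -/
theorem exists_mem_eval_treeOracle {C : Set (ℕ → Bool)} {G : ℕ → List (List Bool)}
    (hG : ∀ l, IsTrunc C l (G l)) {c : OracleCode} {n v : ℕ}
    (h : v ∈ c.eval (codedCharFun (initialSegmentTree C)) n) :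
    ∀ᶠ l in Filter.atTop, v ∈ c.eval (treeOracle l (G l)) n := by
  have hmono : ∀ i j, i ≤ j → ∀ k w, w ∈ treeOracle i (G i) k → w ∈ treeOracle j (G j) k := by
    intro i j hij k w hw
    rw [mem_treeOracle_iff (hG _)] at hw ⊢
    exact ⟨fun s hs => (hw.1 s hs).trans hij, hw.2⟩
  obtain ⟨i, hi⟩ := OracleCode.exists_mem_eval_of_mem_eval (G := fun l => treeOracle l (G l))
    hmono (fun k w hw => by
      simp only [mem_treeOracle_iff (hG _), hw, and_true]
      cases Encodable.decode (α := List Bool) k with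
      | none => exact ⟨0, by simp⟩
      | some s => exact ⟨s.length, by simp⟩) c n v h
  filter_upwards [Filter.eventually_ge_atTop i] with j hij
  exact OracleCode.mem_eval_mono (hmono i j hij) c n v hi

theorem mem_eval_of_mem_eval_treeOracle {C : Set (ℕ → Bool)} {l : ℕ} {G : List (List Bool)}
    (hG : IsTrunc C l G) {c : OracleCode} {n v : ℕ} (h : v ∈ c.eval (treeOracle l G) n) :
    v ∈ c.eval (codedCharFun (initialSegmentTree C)) n :=
  OracleCode.mem_eval_mono (fun _ _ hw => ((mem_treeOracle_iff hG).1 hw).2) c n v h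

theorem initSeg_eq_mono {x y : ℕ → Bool} {m n : ℕ} (hmn : m ≤ n) (h : initSeg x n = initSeg y n) :
    initSeg x m = initSeg y m := by
  have := initSeg_eq_of_prefix (h ▸ initSeg_prefix x hmn : initSeg x m <+: initSeg y n)
  simpa using this.symm

theorem inter_cyl_eq {B : List (List Bool)} {s : List Bool} {l : ℕ} (hl : s.length ≤ l) :
    {x | initSeg x l ∈ B} ∩ cyl s = {x | initSeg x l ∈ B.filter (s <+: ·)} := by
  ext x
  simp only [Set.mem_inter_iff, Set.mem_ofPred_eq, List.mem_filter, decide_eq_true_eq]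
  refine and_congr_right fun _ => ⟨fun h => ?_, fun h => initSeg_eq_of_prefix h⟩
  have := initSeg_prefix x hl
  rwa [show initSeg x s.length = s from h] at this

/-- Strings of length `l` all have cylinders of measure `2⁻ˡ`, so counting them is the same as
measuring. -/
theorem HalfDense.le_measureReal {F B : List (List Bool)} {l : ℕ} (h : HalfDense F l B)
    (hB : B.Nodup) (hlen : ∀ t ∈ B, t.length = l) {s : List Bool} (hs : s ∈ F)
    (hl : s.length ≤ l) :
    1 / 2 * (1 / 2) ^ s.length ≤ coinMeasure.real ({x | initSeg x l ∈ B} ∩ cyl s) := by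
  rw [inter_cyl_eq hl, measureReal_initSeg_mem (hB.filter _)
    fun t ht => hlen t (List.mem_of_mem_filter ht)]
  have h1 : (2 : ℝ) ^ l ≤ 2 * 2 ^ s.length * (B.filter (s <+: ·)).length := by
    exact_mod_cast h s hs
  have h2 : (0 : ℝ) < 2 ^ l := by positivity
  have h3 : (0 : ℝ) < 2 ^ s.length := by positivity
  rw [one_div, inv_pow, inv_pow, ← mul_inv, ← div_eq_mul_inv, inv_eq_one_div,
    div_le_div_iff₀ (by positivity) h2]
  linarith

/-- If the value `v` at `n` is not forced, then avoiding it amounts to shrinking the reservoir. -/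
theorem exists_isClosed_of_not_forced {c : OracleCode} {F : List (List Bool)} {m₀ n v : ℕ}
    (hF : ∀ s ∈ F, s.length = m₀) (h : ¬ Forced c F n v) :
    ∃ K, IsClosed K ∧ (∀ s ∈ F, 1 / 2 * (1 / 2) ^ m₀ ≤ coinMeasure.real (K ∩ cyl s)) ∧
      ∀ C ⊆ K, IsTrunc C m₀ F → v ∉ c.eval (codedCharFun (initialSegmentTree C)) n := by
  classical
  have hbad : ∀ l, ∃ B : List (List Bool), m₀ ≤ l → B ∈ (levelStrings l).sublists' ∧
      HalfDense F l B ∧ ∀ G ∈ B.sublists', Spans F G → v ∉ c.eval (treeOracle l G) n := by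
    intro l
    by_cases hl : m₀ ≤ l
    · by_contra! hcon
      refine h ⟨l, fun s hs => (hF s hs).trans_le hl, fun B hB hd => ?_⟩
      obtain ⟨G, hG⟩ := (hcon B).2 hB hd
      exact ⟨G, hG⟩
    · exact ⟨[], fun h => (hl h).elim⟩
  choose B hB using hbad
  let E : ℕ → Set (ℕ → Bool) := fun l => {x | initSeg x l ∈ B l}
  -- The limit of the bad clopen sets `E l` is taken along a nonprincipal ultrafilter, which decides
  -- for each string whether it survives.
  let T : ℕ → Set (List Bool) := fun m =>
    {s | ∀ᶠ l in (Filter.hyperfilter ℕ : Filter ℕ), ∃ x ∈ E l, initSeg x m = s}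
  -- Only finitely many strings have length `m`, so a single large `l` realizes the limit exactly up
  -- to level `m`.
  have hT : ∀ m, ∃ l, m ≤ l ∧ m₀ ≤ l ∧
      ∀ y, initSeg y m ∈ T m ↔ ∃ x ∈ E l, initSeg x m = initSeg y m := by
    intro m
    have h1 : ∀ᶠ l in (Filter.hyperfilter ℕ : Filter ℕ), ∀ s ∈ {s | s ∈ levelStrings m},
        (s ∈ T m ↔ ∃ x ∈ E l, initSeg x m = s) := by
      refine (Filter.eventually_all_finite (List.finite_toSet _)).2 fun s _ => ?_
      by_cases hs : s ∈ T m
      · filter_upwards [hs] with l hl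
        exact ⟨fun _ => hl, fun _ => hs⟩
      · filter_upwards [Ultrafilter.eventually_not.2 hs] with l hl
        exact ⟨fun h => (hs h).elim, fun h => (hl h).elim⟩
    have h2 := (Filter.eventually_ge_atTop (max m m₀)).filter_mono Nat.hyperfilter_le_atTop
    obtain ⟨l, h1, h2⟩ := (h1.and h2).exists
    exact ⟨l, (le_max_left _ _).trans h2, (le_max_right _ _).trans h2,
      fun y => h1 _ (mem_levelStrings.2 (by simp))⟩
  have hTmono : ∀ {x m n}, m ≤ n → initSeg x n ∈ T n → initSeg x m ∈ T m := by
    intro x m n hmn hx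
    filter_upwards [hx] with l ⟨y, hy, hyx⟩
    exact ⟨y, hy, initSeg_eq_mono hmn hyx⟩
  refine ⟨{x | ∀ m, initSeg x m ∈ T m}, ?_, ?_, ?_⟩
  · rw [Set.ofPred_forall]
    exact isClosed_iInter fun m => (isClopen_initSeg_mem m (T m)).isClosed
  · intro s hs
    let S : ℕ → Set (List Bool) := fun m => {t | t ∈ T m ∧ ∃ x ∈ cyl s, initSeg x m = t}
    have hS : {x | ∀ m, initSeg x m ∈ S m} = {x | ∀ m, initSeg x m ∈ T m} ∩ cyl s := by
      ext x
      refine ⟨fun hx => ⟨fun m => (hx m).1, ?_⟩, fun hx m => ⟨hx.1 m, x, hx.2, rfl⟩⟩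
      obtain ⟨-, y, hy, hyx⟩ := hx s.length
      exact hyx.symm.trans hy
    have hanti : Antitone fun m => {x | initSeg x m ∈ S m} := by
      rintro m n hmn x ⟨hx, y, hy, hyx⟩
      exact ⟨hTmono hmn hx, y, hy, initSeg_eq_mono hmn hyx⟩
    rw [← hS, ← hF s hs]
    refine ge_of_tendsto' (measureReal_initSeg_mem_tendsto hanti) fun m => ?_
    -- The level-`m` hull of the limit contains `E l`, so it inherits the lower bound one half;
    -- continuity from above passes it to the limit.
    obtain ⟨l, -, hl, hlT⟩ := hT m
    obtain ⟨hBl, hd, -⟩ := hB l hl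
    have hsub := List.mem_sublists'.1 hBl
    refine (hd.le_measureReal ((nodup_levelStrings l).sublist hsub)
      (fun t ht => mem_levelStrings.1 (hsub.subset ht)) hs ((hF s hs).trans_le hl)).trans ?_
    refine measureReal_mono ?_ (measure_ne_top _ _)
    rintro x ⟨hx, hxs⟩
    exact ⟨(hlT x).2 ⟨x, hx, rfl⟩, x, hxs, rfl⟩
  · intro C hC hCF hv
    choose G hG using exists_isTrunc C
    obtain ⟨m, hm, hm₀⟩ := ((exists_mem_eval_treeOracle hG hv).and
      (Filter.eventually_ge_atTop m₀)).exists
    obtain ⟨l, hml, hl, hlT⟩ := hT m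
    -- `C` need not lie in `E l`. Its substitute `D` does, and has the same tree up to level `m`,
    -- which is all that the computation uses.
    let D : Set (ℕ → Bool) := {x | x ∈ E l ∧ ∃ y ∈ C, initSeg y m = initSeg x m}
    have hDy : ∀ y ∈ C, ∃ x ∈ D, initSeg x m = initSeg y m := by
      intro y hy
      obtain ⟨x, hx, hxy⟩ := (hlT y).1 (hC hy m)
      exact ⟨x, ⟨hx, y, hy, hxy.symm⟩, hxy⟩
    have hDm : IsTrunc D m (G m) := by
      intro s
      rw [hG m s]
      constructor
      · rintro ⟨y, hy, rfl⟩
        exact hDy y hy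
      · rintro ⟨x, ⟨-, y, hy, hyx⟩, rfl⟩
        exact ⟨y, hy, hyx⟩
    obtain ⟨G', hG', hDl⟩ : ∃ G' ∈ (B l).sublists', IsTrunc D l G' := by
      refine ⟨(B l).filter fun s => ∃ x ∈ D, initSeg x l = s,
        List.mem_sublists'.2 List.filter_sublist, fun s => ?_⟩
      simp only [List.mem_filter, decide_eq_true_eq, and_iff_right_iff_imp]
      rintro ⟨x, hx, rfl⟩
      exact hx.1
    refine (hB l hl).2.2 G' hG' ⟨?_, ?_⟩
      (OracleCode.mem_eval_mono (fun k w hw => ?_) c n v hm)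
    · intro t ht
      obtain ⟨x, ⟨-, y, hy, hyx⟩, rfl⟩ := (hDl t).1 ht
      refine ⟨_, (hCF _).2 ⟨y, hy, rfl⟩, ?_⟩
      rw [initSeg_eq_mono hm₀ hyx]
      exact initSeg_prefix x hl
    · intro s hs
      obtain ⟨y, hy, rfl⟩ := (hCF s).1 hs
      obtain ⟨x, hx, hxy⟩ := hDy y hy
      refine ⟨_, (hDl _).2 ⟨x, hx, rfl⟩, ?_⟩
      rw [← initSeg_eq_mono hm₀ hxy]
      exact initSeg_prefix x hl
    · rw [mem_treeOracle_iff hDm] at hw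
      exact (mem_treeOracle_iff hDl).2 ⟨fun s hs => (hw.1 s hs).trans hml, hw.2⟩

/-! ### Forcing conditions and their extensions -/

/-- A forcing condition: a finite tree, all of whose leaves have the same length, and a closed
reservoir which is dense above each leaf. -/
structure TreeCondition where
  height : ℕ
  leaves : List (List Bool)
  reservoir : Set (ℕ → Bool)
  leaves_ne : leaves ≠ []
  length_eq : ∀ s ∈ leaves, s.length = height
  isClosed : IsClosed reservoir
  dense : ∀ s ∈ leaves, 1 / 2 * (1 / 2) ^ height < coinMeasure.real (reservoir ∩ cyl s)

namespace TreeCondition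

/-- The tree of `q` end-extends the tree of `p`, and `q` has the smaller reservoir. -/
structure Extends (q p : TreeCondition) : Prop where
  subset : q.reservoir ⊆ p.reservoir
  spans : Spans p.leaves q.leaves

theorem _root_.Spans.trans {F G H : List (List Bool)} (h : Spans F G) (h' : Spans G H) :
    Spans F H := by
  refine ⟨fun u hu => ?_, fun s hs => ?_⟩
  · obtain ⟨t, ht, htu⟩ := h'.1 u hu
    obtain ⟨s, hs, hst⟩ := h.1 t ht
    exact ⟨s, hs, hst.trans htu⟩
  · obtain ⟨t, ht, hst⟩ := h.2 s hs
    obtain ⟨u, hu, htu⟩ := h'.2 t ht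
    exact ⟨u, hu, hst.trans htu⟩

theorem Extends.trans {p q r : TreeCondition} (h : r.Extends q) (h' : q.Extends p) :
    r.Extends p :=
  ⟨h.subset.trans h'.subset, h'.spans.trans h.spans⟩

theorem _root_.exists_treeCondition_spans {K : Set (ℕ → Bool)} (hK : IsClosed K)
    {G : List (List Bool)} (hne : G ≠ []) (hG : ∀ t ∈ G, 0 < coinMeasure.real (K ∩ cyl t)) (m : ℕ) :
    ∃ q : TreeCondition, q.reservoir = K ∧ m ≤ q.height ∧ Spans G q.leaves := by
  have h : ∀ᶠ n in Filter.atTop, ∀ s ∈ {s | s ∈ G}, ∃ t : List Bool, t.length = n ∧ s <+: t ∧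
      1 / 2 * (1 / 2) ^ n < coinMeasure.real (K ∩ cyl t) :=
    (Filter.eventually_all_finite (List.finite_toSet _)).2 fun s hs =>
      eventually_exists_dense_extension hK (hG s hs)
  obtain ⟨n, h, hmn⟩ := (h.and (Filter.eventually_ge_atTop m)).exists
  choose! f hf using h
  refine ⟨⟨n, G.map f, K, by simpa using hne, ?_, hK, ?_⟩, rfl, hmn, ?_, fun s hs => ⟨f s, List.mem_map_of_mem hs,
    (hf s hs).2.1⟩⟩
  · intro t ht
    obtain ⟨s, hs, rfl⟩ := List.mem_map.1 ht
    exact (hf s hs).1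
  · intro t ht
    obtain ⟨s, hs, rfl⟩ := List.mem_map.1 ht
    exact (hf s hs).2.2
  · intro t ht
    obtain ⟨s, hs, rfl⟩ := List.mem_map.1 ht
    exact ⟨s, hs, (hf s hs).2.1⟩

/-- Each leaf of `p` branches in `q`. -/
def Splits (q p : TreeCondition) : Prop :=
  ∀ s ∈ p.leaves, ∃ t₁ ∈ q.leaves, ∃ t₂ ∈ q.leaves, t₁ ≠ t₂ ∧ s <+: t₁ ∧ s <+: t₂

/-- The other child carries only half of the cylinder, while the reservoir fills strictly more than
half. -/
theorem measureReal_child_pos (p : TreeCondition) {s : List Bool} (hs : s ∈ p.leaves) (b : Bool) :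
    0 < coinMeasure.real (p.reservoir ∩ cyl (s ++ [b])) := by
  have hsub : p.reservoir ∩ cyl s ⊆ (p.reservoir ∩ cyl (s ++ [b])) ∪ cyl (s ++ [!b]) := by
    rintro x ⟨hx, hxs⟩
    have hxs : initSeg x s.length = s := hxs
    by_cases hb : x s.length = b
    · exact Or.inl ⟨hx, by simp [cyl, initSeg_succ, hxs, hb]⟩
    · exact Or.inr (by simp [cyl, initSeg_succ, hxs]; cases b <;> simp_all)
  have h1 := (measureReal_mono hsub (measure_ne_top coinMeasure _)).trans (measureReal_union_le _ _)
  rw [coinMeasure_real_cyl, List.length_append, p.length_eq s hs, List.length_singleton,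
    pow_succ'] at h1
  linarith [p.dense s hs]

theorem exists_splits (p : TreeCondition) (m : ℕ) :
    ∃ q : TreeCondition, q.Extends p ∧ q.Splits p ∧ m ≤ q.height := by
  obtain ⟨q, hq, hm, hspan⟩ := exists_treeCondition_spans p.isClosed
    (G := p.leaves.flatMap fun s => [s ++ [false], s ++ [true]])
    (by simp [List.flatMap_eq_nil_iff, List.exists_mem_of_ne_nil _ p.leaves_ne]) (fun t ht => by
      obtain ⟨s, hs, ht⟩ := List.mem_flatMap.1 ht
      simp only [List.mem_cons, List.not_mem_nil, or_false] at ht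
      rcases ht with rfl | rfl <;> exact p.measureReal_child_pos hs _) m
  have hchild : ∀ s ∈ p.leaves, ∀ b, ∃ t ∈ q.leaves, s ++ [b] <+: t := fun s hs b =>
    hspan.2 _ (List.mem_flatMap.2 ⟨s, hs, by cases b <;> simp⟩)
  refine ⟨q, ⟨hq.subset, fun t ht => ?_, fun s hs => ?_⟩, fun s hs => ?_, hm⟩
  · obtain ⟨u, hu, hut⟩ := hspan.1 t ht
    obtain ⟨s, hs, hu⟩ := List.mem_flatMap.1 hu
    refine ⟨s, hs, List.IsPrefix.trans ?_ hut⟩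
    simp only [List.mem_cons, List.not_mem_nil, or_false] at hu
    rcases hu with rfl | rfl <;> exact List.prefix_append _ _
  · obtain ⟨t, ht, hst⟩ := hchild s hs true
    exact ⟨t, ht, (List.prefix_append _ _).trans hst⟩
  · obtain ⟨t₁, ht₁, h₁⟩ := hchild s hs false
    obtain ⟨t₂, ht₂, h₂⟩ := hchild s hs true
    refine ⟨t₁, ht₁, t₂, ht₂, ?_, (List.prefix_append _ _).trans h₁,
      (List.prefix_append _ _).trans h₂⟩
    rintro rfl
    have := (List.prefix_of_prefix_length_le h₁ h₂ (by simp)).eq_of_length (by simp)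
    simp at this

/-- No set with the truncation and reservoir prescribed by `q` computes `X` via `c`. -/
def ForcesNe (q : TreeCondition) (c : OracleCode) (X : Set ℕ) : Prop :=
  ∀ C ⊆ q.reservoir, IsTrunc C q.height q.leaves →
    c.eval (codedCharFun (initialSegmentTree C)) ≠ codedCharFun X

/-- The discarded strings carry only a null part of the reservoir, so the kept ones cover more than
half of the cylinder above each leaf. -/
theorem exists_halfDense (p : TreeCondition) {l : ℕ} (hl : p.height ≤ l) :
    ∃ B ∈ (levelStrings l).sublists', HalfDense p.leaves l B ∧
      ∀ t ∈ B, 0 < coinMeasure.real (p.reservoir ∩ cyl t) := by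
  classical
  set B := (levelStrings l).filter fun t => 0 < coinMeasure.real (p.reservoir ∩ cyl t) with hB
  set N := (levelStrings l).filter fun t => ¬ 0 < coinMeasure.real (p.reservoir ∩ cyl t) with hN
  have hBl : ∀ t ∈ B, t.length = l := fun t ht => mem_levelStrings.1 (List.mem_of_mem_filter ht)
  refine ⟨B, List.mem_sublists'.2 List.filter_sublist, fun s hs => ?_, fun t ht => by
    simpa using (List.mem_filter.1 ht).2⟩
  have hsl := p.length_eq s hs
  have hsub : p.reservoir ∩ cyl s ⊆
      (p.reservoir ∩ {x | initSeg x l ∈ B.filter (s <+: ·)}) ∪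
      (p.reservoir ∩ {x | initSeg x l ∈ N}) := by
    rintro x ⟨hx, hxs⟩
    by_cases hpos : 0 < coinMeasure.real (p.reservoir ∩ cyl (initSeg x l))
    · refine Or.inl ⟨hx, ?_⟩
      rw [← inter_cyl_eq (hsl.trans_le hl)]
      exact ⟨List.mem_filter.2 ⟨mem_levelStrings.2 (by simp), by simpa using hpos⟩, hxs⟩
    · exact Or.inr ⟨hx, List.mem_filter.2 ⟨mem_levelStrings.2 (by simp), by simpa using hpos⟩⟩
  have h1 := (measureReal_mono hsub (measure_ne_top coinMeasure _)).trans (measureReal_union_le _ _)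
  have h2 := measureReal_inter_initSeg_mem_le (K := p.reservoir) (n := l) (c := (1 / 2) ^ l)
    (B := B.filter (s <+: ·)) (fun t ht => hBl t (List.mem_of_mem_filter ht)) fun t ht => by
      rw [← hBl t (List.mem_of_mem_filter ht), ← coinMeasure_real_cyl]
      exact measureReal_mono Set.inter_subset_right (measure_ne_top _ _)
  have h3 := measureReal_inter_initSeg_mem_le (K := p.reservoir) (n := l) (c := 0) (B := N)
    (fun t ht => mem_levelStrings.1 (List.mem_of_mem_filter ht)) fun t ht => by
      simpa using (List.mem_filter.1 ht).2
  have h4 := p.dense s hs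
  have h5 : 1 / 2 * (1 / 2 : ℝ) ^ p.height ≤ (B.filter (s <+: ·)).length * (1 / 2) ^ l := by
    linarith
  have h6 : (2 : ℝ) ^ l ≤ 2 * 2 ^ p.height * (B.filter (s <+: ·)).length := by
    rw [one_div, inv_pow, inv_pow, ← mul_inv, ← div_eq_mul_inv, inv_eq_one_div,
      div_le_div_iff₀ (by positivity) (by positivity)] at h5
    linarith
  rw [hsl]
  exact_mod_cast h6

theorem exists_forcesNe (p : TreeCondition) (c : OracleCode) {X : Set ℕ}
    (hX : ¬ ComputablePred fun n : ℕ => n ∈ X) :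
    ∃ q : TreeCondition, q.Extends p ∧ q.ForcesNe c X := by
  classical
  by_cases h1 : ∃ n v, Forced c p.leaves n v ∧ v ∉ codedCharFun X n
  -- A wrong value is forced: make the computation producing it part of the tree.
  · obtain ⟨n, v, ⟨l, hlen, hl⟩, hv⟩ := h1
    obtain ⟨s₀, hs₀⟩ := List.exists_mem_of_ne_nil _ p.leaves_ne
    have hpl : p.height ≤ l := (p.length_eq s₀ hs₀).symm.trans_le (hlen s₀ hs₀)
    obtain ⟨B, hB, hd, hpos⟩ := p.exists_halfDense hpl
    obtain ⟨G, hGB, hspan, hvG⟩ := hl B hB hd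
    have hsub := List.mem_sublists'.1 hGB
    obtain ⟨q, hq, -, hGq⟩ := exists_treeCondition_spans p.isClosed
      (fun h => by simpa [h] using hspan.2 s₀ hs₀) (fun t ht => hpos t (hsub.subset ht)) 0
    refine ⟨q, ⟨hq.subset, hspan.trans hGq⟩, fun C _ hC hcon => hv ?_⟩
    rw [← hcon]
    exact mem_eval_of_mem_eval_treeOracle (spans_trunc_eq
      (fun s hs => mem_levelStrings.1 ((List.mem_sublists'.1 hB).subset (hsub.subset hs))) hGq hC) hvG
  by_cases h2 : ∃ n v, ¬ Forced c p.leaves n v ∧ v ∈ codedCharFun X n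
  -- The correct value is not forced: keep the tree up to extension and shrink the reservoir so that
  -- this value never appears.
  · obtain ⟨n, v, hn, hv⟩ := h2
    obtain ⟨K, hK, hKd, hKC⟩ := exists_isClosed_of_not_forced p.length_eq hn
    obtain ⟨q, hq, -, hspan⟩ := exists_treeCondition_spans (G := p.leaves) (p.isClosed.inter hK)
      p.leaves_ne (fun s hs => by
        -- Inclusion-exclusion inside `cyl s`: more than half plus at least half exceeds the whole,
        -- so the overlap has positive measure.
        have h3 := measureReal_union_add_inter (μ := coinMeasure) (s := p.reservoir ∩ cyl s)
          (t := K ∩ cyl s) (hK.measurableSet.inter (isClopen_cyl s).isOpen.measurableSet)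
        have h4 : coinMeasure.real ((p.reservoir ∩ cyl s) ∪ (K ∩ cyl s)) ≤ (1 / 2) ^ p.height := by
          rw [← p.length_eq s hs, ← coinMeasure_real_cyl]
          exact measureReal_mono (Set.union_subset Set.inter_subset_right Set.inter_subset_right)
            (measure_ne_top _ _)
        rw [Set.inter_inter_distrib_right]
        linarith [p.dense s hs, hKd s hs]) 0
    refine ⟨q, ⟨hq.subset.trans Set.inter_subset_left, hspan⟩, fun C hCq hC hcon => ?_⟩
    refine hKC C (hCq.trans (hq.subset.trans Set.inter_subset_right))
      (spans_trunc_eq p.length_eq hspan hC) ?_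
    rw [hcon]
    exact hv
  push Not at h1 h2
  refine (hX (computablePred_of_forced (c := c) (F := p.leaves) (fun n => ⟨fun h => ?_, fun h => ?_⟩)
    fun n => ⟨fun h => ?_, fun h => ?_⟩)).elim
  · have := h1 n 1 h
    simpa [codedCharFun] using this
  · by_contra hcon
    exact h2 n 1 hcon (by simpa [codedCharFun] using h)
  · have := h1 n 0 h
    simpa [codedCharFun] using this
  · by_contra hcon
    exact h2 n 0 hcon (by simpa [codedCharFun] using h)

end TreeCondition

/-! ### The perfect set determined by a sequence of conditions -/

namespace TreeCondition

theorem ForcesNe.mono {p q : TreeCondition} {c : OracleCode} {X : Set ℕ} (h : p.ForcesNe c X)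
    (hqp : q.Extends p) : q.ForcesNe c X :=
  fun C hC hCq => h C (hC.trans hqp.subset) (spans_trunc_eq p.length_eq hqp.spans hCq)

theorem exists_step (p : TreeCondition) (c : OracleCode) {X : Set ℕ}
    (hX : ¬ ComputablePred fun n : ℕ => n ∈ X) :
    ∃ q : TreeCondition, q.Extends p ∧ q.Splits p ∧ p.height < q.height ∧ q.ForcesNe c X := by
  obtain ⟨r, hrp, hr⟩ := p.exists_forcesNe c hX
  obtain ⟨q, hqr, hsplit, hq⟩ := r.exists_splits (p.height + 1)
  refine ⟨q, hqr.trans hrp, fun s hs => ?_, hq, hr.mono hqr⟩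
  obtain ⟨t, ht, hst⟩ := hrp.spans.2 s hs
  obtain ⟨t₁, ht₁, t₂, ht₂, hne, h₁, h₂⟩ := hsplit t ht
  exact ⟨t₁, ht₁, t₂, ht₂, hne, hst.trans h₁, hst.trans h₂⟩

/-- The closed set determined by a sequence of conditions. -/
def limitSet (p : ℕ → TreeCondition) : Set (ℕ → Bool) :=
  {x | ∀ n, initSeg x (p n).height ∈ (p n).leaves}

variable {p : ℕ → TreeCondition}

theorem extends_of_lt (hext : ∀ n, (p (n + 1)).Extends (p n)) {m n : ℕ} (h : m < n) :
    (p n).Extends (p m) := by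
  induction n, h using Nat.le_induction with
  | base => exact hext m
  | succ n _ ih => exact (hext n).trans ih

theorem isClosed_limitSet : IsClosed (limitSet p) := by
  rw [limitSet, Set.ofPred_forall]
  exact isClosed_iInter fun n =>
    (isClopen_initSeg_mem (p n).height {s | s ∈ (p n).leaves}).isClosed

theorem initSeg_mem_of_lt (hext : ∀ n, (p (n + 1)).Extends (p n)) {m n : ℕ} (h : m < n)
    {x : ℕ → Bool} (hx : initSeg x (p n).height ∈ (p n).leaves) :
    initSeg x (p m).height ∈ (p m).leaves := by
  obtain ⟨s, hs, hsx⟩ := (extends_of_lt hext h).spans.1 _ hx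
  have := initSeg_eq_of_prefix hsx
  rw [(p m).length_eq s hs] at this
  rwa [this]

/-- Compactness shows that no leaf dies out: above a leaf, the later stages cut out decreasing
nonempty clopen sets, which have a common point. -/
theorem isTrunc_limitSet (hext : ∀ n, (p (n + 1)).Extends (p n)) (n : ℕ) :
    IsTrunc (limitSet p) (p n).height (p n).leaves := by
  intro s
  constructor
  · intro hs
    have hne := IsCompact.nonempty_iInter_of_sequence_nonempty_isCompact_isClosed
      (fun j => {x | initSeg x (p (n + j)).height ∈ (p (n + j)).leaves} ∩ cyl s)
      (fun j x hx => ⟨initSeg_mem_of_lt hext (by omega) hx.1, hx.2⟩) (fun j => ?_)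
      (((isClopen_initSeg_mem _ {s | s ∈ (p (n + 0)).leaves}).isClosed.inter
        (isClopen_cyl s).isClosed).isCompact)
      (fun j => (isClopen_initSeg_mem _ {s | s ∈ (p (n + j)).leaves}).isClosed.inter
        (isClopen_cyl s).isClosed)
    · obtain ⟨x, hx⟩ := hne
      simp only [Set.mem_iInter] at hx
      refine ⟨x, fun m => ?_, ?_⟩
      · exact initSeg_mem_of_lt hext (n := n + (m + 1)) (by omega) (hx (m + 1)).1
      · rw [← (p n).length_eq s hs]
        exact (hx 0).2
    · obtain ⟨t, ht, hst⟩ : ∃ t ∈ (p (n + j)).leaves, s <+: t := by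
        cases j with
        | zero => exact ⟨s, hs, List.prefix_rfl⟩
        | succ j => exact (extends_of_lt hext (by omega)).spans.2 s hs
      obtain ⟨x, hx⟩ := exists_initSeg_eq t
      refine ⟨x, ?_, cyl_subset hst hx⟩
      rw [(p (n + j)).length_eq t ht] at hx
      rw [Set.mem_ofPred_eq, hx]
      exact ht
  · rintro ⟨x, hx, rfl⟩
    exact hx n

theorem strictMono_height (hlt : ∀ n, (p n).height < (p (n + 1)).height) :
    StrictMono fun n => (p n).height := strictMono_nat_of_lt_succ hlt

/-- Arbitrarily long initial segments of a limit point are leaves of later conditions. Density makes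
their cylinders meet the later reservoirs, hence the earlier one, which is closed. -/
theorem limitSet_subset (hext : ∀ n, (p (n + 1)).Extends (p n))
    (hlt : ∀ n, (p n).height < (p (n + 1)).height) (n : ℕ) :
    limitSet p ⊆ (p n).reservoir := by
  intro x hx
  refine mem_of_initSeg (p n).isClosed fun m => ⟨(p (n + (m + 1))).height, ?_, ?_⟩
  · have := (strictMono_height hlt).le_apply (x := n + (m + 1))
    omega
  · have hpos := (p (n + (m + 1))).dense _ (hx (n + (m + 1)))
    obtain ⟨y, hy, hyx⟩ := nonempty_of_measureReal_ne_zero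
      ((lt_trans (by positivity) hpos).ne')
    refine ⟨y, (extends_of_lt hext (by omega)).subset hy, ?_⟩
    simpa [cyl] using hyx

theorem perfect_limitSet (hext : ∀ n, (p (n + 1)).Extends (p n))
    (hlt : ∀ n, (p n).height < (p (n + 1)).height) (hsplit : ∀ n, (p (n + 1)).Splits (p n)) :
    Perfect (limitSet p) := by
  refine ⟨isClosed_limitSet, fun x hx => accPt_iff_nhds.2 fun U hU => ?_⟩
  obtain ⟨n, hn⟩ := exists_initSeg_subset_of_mem_nhds hU
  have hnh : n ≤ (p n).height := (strictMono_height hlt).le_apply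
  -- At most one of the two leaves is an initial segment of `x`; the other leads to a different
  -- limit point in the same neighbourhood.
  obtain ⟨t₁, ht₁, t₂, ht₂, hne, h₁, h₂⟩ := hsplit n _ (hx n)
  have key : ∀ t ∈ (p (n + 1)).leaves, initSeg x (p n).height <+: t →
      ∃ y ∈ U ∩ limitSet p, initSeg y (p (n + 1)).height = t := by
    intro t ht hxt
    obtain ⟨y, hy, hyt⟩ := (isTrunc_limitSet hext (n + 1) t).1 ht
    refine ⟨y, ⟨hn _ hnh y ?_, hy⟩, hyt⟩
    have := initSeg_eq_of_prefix (hyt ▸ hxt : _ <+: initSeg y (p (n + 1)).height)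
    simpa using this
  by_cases hx₁ : initSeg x (p (n + 1)).height = t₁
  · obtain ⟨y, hy, hyt⟩ := key t₂ ht₂ h₂
    exact ⟨y, hy, fun h => hne (by rw [← hx₁, ← hyt, h])⟩
  · obtain ⟨y, hy, hyt⟩ := key t₁ ht₁ h₁
    exact ⟨y, hy, fun h => hx₁ (by rw [← hyt, h])⟩

end TreeCondition

/-! ### Inner regularity and the construction -/

theorem exists_isClosed_subset_measureReal_pos {A : Set (ℕ → Bool)}
    (hA : NullMeasurableSet A coinMeasure) (hpos : 0 < coinMeasure A) :
    ∃ K ⊆ A, IsClosed K ∧ 0 < coinMeasure.real K := by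
  obtain ⟨A', hA'A, hA', hae⟩ := hA.exists_measurable_subset_ae_eq
  rw [← measure_congr hae] at hpos
  obtain ⟨K, hKA, hK, hKpos⟩ := hA'.exists_lt_isClosed_of_ne_top (measure_ne_top _ _) hpos
  exact ⟨K, hKA.trans hA'A, hK, ENNReal.toReal_pos hKpos.ne' (measure_ne_top _ _)⟩

theorem corollary2p9 (X : Set ℕ) (hX : ¬ ComputablePred fun n : ℕ => n ∈ X)
    (A : Set (ℕ → Bool)) (hA : MeasureTheory.NullMeasurableSet A coinMeasure)
    (hpos : 0 < coinMeasure A) :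
    ∃ C : Set (ℕ → Bool), C ⊆ A ∧ C.Nonempty ∧ Perfect C ∧
      ¬ ComputesSet (initialSegmentTree C) X := by
  obtain ⟨K, hKA, hK, hKpos⟩ := exists_isClosed_subset_measureReal_pos hA hpos
  -- The empty string is the only member of the initial tree, and its cylinder is the whole space.
  obtain ⟨p₀, hp₀, -, -⟩ := exists_treeCondition_spans hK (G := [[]]) (by simp)
    (by simpa [cyl, initSeg] using hKpos) 0
  have : Nonempty OracleCode := ⟨.zero⟩
  obtain ⟨e, he⟩ := exists_surjective_nat OracleCode
  choose next hext hsplit hlt hne using fun (p : TreeCondition) c => p.exists_step c hX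
  -- Passing from `p n` to `p (n + 1)` defeats program `e n`, adds branching and increases the
  -- height.
  let p : ℕ → TreeCondition := fun n => Nat.rec p₀ (fun n q => next q (e n)) n
  have hext' : ∀ n, (p (n + 1)).Extends (p n) := fun n => hext (p n) (e n)
  have hlt' : ∀ n, (p n).height < (p (n + 1)).height := fun n => hlt (p n) (e n)
  refine ⟨TreeCondition.limitSet p, ?_, ?_, ?_, fun h => ?_⟩
  · exact ((TreeCondition.limitSet_subset hext' hlt' 0).trans hp₀.subset).trans hKA
  · obtain ⟨s, hs⟩ := List.exists_mem_of_ne_nil _ (p 0).leaves_ne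
    obtain ⟨x, hx, -⟩ := (TreeCondition.isTrunc_limitSet hext' 0 s).1 hs
    exact ⟨x, hx⟩
  · exact TreeCondition.perfect_limitSet hext' hlt' fun n => hsplit (p n) (e n)
  · obtain ⟨c, hc⟩ := OracleCode.exists_eval_eq_of_turingReducible h
    obtain ⟨n, rfl⟩ := he c
    exact hne (p n) (e n) _ (TreeCondition.limitSet_subset hext' hlt' (n + 1))
      (TreeCondition.isTrunc_limitSet hext' (n + 1)) hc
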